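/- Let $n,M\ge 0$ be integers, let $S$ and $N$ be independent $\mathbb{R}^n$-valued random vectors on a common probability space, and put $X=S+N$. Assume that $S$ has finite second moments and that its covariance matrix $C_S=\mathbb{E}\left[(S-\mathbb{E}S)(S-\mathbb{E}S)^T\right]$ has rank at most $M$, and that $N$ is Gaussian with mean zero and covariance matrix $\sigma^2 I$ for some $\sigma\in\mathbb{R}$. Let $W$ be any orthogonal $n\times n$ matrix whose columns are eigenvectors of the covariance matrix $C_X$ of $X$, ordered such that the corresponding eigenvalues are descending, $\lambda_1\ge\lambda_2\ge\dots\ge\lambda_n$. Let $Y_M=I_M W^T X$ be the output of the principal component analysis reduced to $M$ components, where $I_M$ is the $M\times n$ matrix with ones on the main diagonal and zeros elsewhere. For $Y=g(X)$ with a measurable function $g$, the information loss relevant with respect to $S$ is $$L_S(X\to Y)=\sup_{\mathcal P}\left(I(\hat S;X)-I(\hat S;Y)\right),$$ where $I$ denotes mutual information, the supremum is over all finite or countable measurable partitions $\mathcal P$ of the sample space of $S$ for which the difference is defined (is not $\infty-\infty$), and $\hat S$ is $S$ quantized according to $\mathcal P$, i.e. the index of the cell of $\mathcal P$ that contains $S$.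 Then $$L_S(X\to Y_M)=0.$$ -/

import Mathlib

open MeasureTheory ProbabilityTheory InformationTheory

noncomputable section

/-- Mutual information `I(U; V)` in nats: the Kullback-Leibler divergence of the joint law
from the product of the marginal laws. -/
def mutualInfo {Ω 𝓤 𝓥 : Type*} [MeasurableSpace Ω] [MeasurableSpace 𝓤] [MeasurableSpace 𝓥]
    (P : Measure Ω) (U : Ω → 𝓤) (V : Ω → 𝓥) : ENNReal :=
  klDiv (P.map (fun ω => (U ω, V ω))) ((P.map U).prod (P.map V))

/-- Information loss relevant with respect to `S` in the system `X ↦ Y = g X`: the supremum of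
`I(Ŝ; X) - I(Ŝ; Y)` over all (finite or countable) measurable partitions of the sample space of
`S`, where `Ŝ = q ∘ S` is the quantization of `S`, the cells of the partition being the nonempty
fibres of `q`. The difference is taken in `EReal`, so that it is not truncated at zero;
undefined differences `∞ - ∞` have the value `⊥` there and do not contribute to the supremum. -/
def relevantInfoLoss {Ω 𝓢 𝓧 𝓨 : Type*} [MeasurableSpace Ω] [MeasurableSpace 𝓢]
    [MeasurableSpace 𝓧] [MeasurableSpace 𝓨]
    (P : Measure Ω) (S : Ω → 𝓢) (X : Ω → 𝓧) (g : 𝓧 → 𝓨) : EReal :=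
  ⨆ (q : 𝓢 → ℕ) (_ : Measurable q),
    ((mutualInfo P (fun ω => q (S ω)) X : ENNReal) : EReal)
      - ((mutualInfo P (fun ω => q (S ω)) (fun ω => g (X ω)) : ENNReal) : EReal)

/-- The covariance matrix of a random vector, with entries
`E[(X i - E[X i]) * (X j - E[X j])]`. -/
def covarianceMatrix {Ω : Type*} [MeasurableSpace Ω] {n : ℕ}
    (P : Measure Ω) (X : Ω → EuclideanSpace ℝ (Fin n)) : Matrix (Fin n) (Fin n) ℝ :=
  Matrix.of fun i j => cov[fun ω => X ω i, fun ω => X ω j; P]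

/-- `W` is an orthogonal matrix whose columns are eigenvectors of `C`, ordered such that the
corresponding eigenvalues are descending. -/
def IsPCAMatrix {n : ℕ} (C W : Matrix (Fin n) (Fin n) ℝ) : Prop :=
  W ∈ Matrix.orthogonalGroup (Fin n) ℝ ∧
    ∃ l : Fin n → ℝ, Antitone l ∧ C * W = W * Matrix.diagonal l

/-- The `M × n` matrix with ones on the main diagonal and zeros elsewhere. -/
def truncationMatrix (M n : ℕ) : Matrix (Fin M) (Fin n) ℝ :=
  Matrix.of fun i j => if (i : ℕ) = (j : ℕ) then 1 else 0

/-- The map `x ↦ I_M Wᵀ x`: rotation by `Wᵀ`, of which the first `M` components are kept. -/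
def pcaMap {n : ℕ} (M : ℕ) (W : Matrix (Fin n) (Fin n) ℝ)
    (x : EuclideanSpace ℝ (Fin n)) : EuclideanSpace ℝ (Fin M) :=
  WithLp.toLp 2 ((truncationMatrix M n * W.transpose).mulVec x.ofLp)

end

/-! Since the noise is isotropic, C_X = C_S + σ²I, so `W` also diagonalizes C_S, with eigenvalues l
i - σ². These are descending, nonnegative (they are variances of the components of Wᵀ S) and at most
`M` are nonzero. Hence the components of Wᵀ S after the first `M` have variance zero and are almost
surely constant (`ae_eq_integral_of_isPCAMatrix`). The components of Wᵀ X that PCA discards are thus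
a constant plus rotated noise. Rotated isotropic Gaussian noise has independent coordinates, so this
part Z is independent of (S, Y_M) (`indepFun_prodMk_pcaMap`). As `X` is almost surely a function of
(Y_M, Z), two uses of data processing give I(Ŝ; X) = I(Ŝ; Y_M) for every quantization
(`mutualInfo_eq_of_indepFun`). -/

/-! ### Mutual information and independent side information -/

theorem klDiv_prod_left {α β : Type*} [MeasurableSpace α] [MeasurableSpace β]
    (μ ν : Measure α) (ρ : Measure β) [IsFiniteMeasure μ] [IsFiniteMeasure ν]
    [IsProbabilityMeasure ρ] : klDiv (μ.prod ρ) (ν.prod ρ) = klDiv μ ν := by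
  rw [← Measure.compProd_const, ← Measure.compProd_const, klDiv_compProd_left]

/-- Mutual information does not increase under processing of the second variable. -/
theorem mutualInfo_comp_right_le {Ω 𝓤 𝓧 𝓨 : Type*} [MeasurableSpace Ω] [MeasurableSpace 𝓤]
    [MeasurableSpace 𝓧] [MeasurableSpace 𝓨] (P : Measure Ω) [IsProbabilityMeasure P]
    {U : Ω → 𝓤} {X : Ω → 𝓧} {g : 𝓧 → 𝓨} (hU : AEMeasurable U P) (hX : AEMeasurable X P)
    (hg : Measurable g) :
    mutualInfo P U (fun ω => g (X ω)) ≤ mutualInfo P U X := by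
  have h₁ : P.map (fun ω => (U ω, g (X ω)))
      = (P.map (fun ω => (U ω, X ω))).map (Prod.map id g) :=
    (AEMeasurable.map_map_of_aemeasurable (measurable_id.prodMap hg).aemeasurable
      (hU.prodMk hX)).symm
  have h₂ : (P.map U).prod (P.map fun ω => g (X ω))
      = ((P.map U).prod (P.map X)).map (Prod.map id g) := by
    rw [← Measure.map_prod_map _ _ measurable_id hg, Measure.map_id,
      AEMeasurable.map_map_of_aemeasurable hg.aemeasurable hX]
    rfl
  rw [mutualInfo, mutualInfo, h₁, h₂]
  exact klDiv_map_le _ _ (measurable_id.prodMap hg)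

/-- Adjoining a variable independent of the pair `(U, Y)` to `Y` does not change the mutual
information of `U` and `Y`. -/
theorem mutualInfo_prodMk_of_indepFun {Ω 𝓤 𝓨 𝓩 : Type*} [MeasurableSpace Ω] [MeasurableSpace 𝓤]
    [MeasurableSpace 𝓨] [MeasurableSpace 𝓩] (P : Measure Ω) [IsProbabilityMeasure P]
    {U : Ω → 𝓤} {Y : Ω → 𝓨} {Z : Ω → 𝓩} (hU : AEMeasurable U P) (hY : AEMeasurable Y P)
    (hZ : AEMeasurable Z P) (h : IndepFun (fun ω => (U ω, Y ω)) Z P) :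
    mutualInfo P U (fun ω => (Y ω, Z ω)) = mutualInfo P U Y := by
  have := Measure.isProbabilityMeasure_map hU
  have := Measure.isProbabilityMeasure_map hY
  have := Measure.isProbabilityMeasure_map hZ
  have := Measure.isProbabilityMeasure_map (hU.prodMk hY)
  have h₁ : P.map (fun ω => (U ω, (Y ω, Z ω)))
      = ((P.map (fun ω => (U ω, Y ω))).prod (P.map Z)).map MeasurableEquiv.prodAssoc := by
    rw [← (indepFun_iff_map_prod_eq_prod_map_map (hU.prodMk hY) hZ).1 h,
      AEMeasurable.map_map_of_aemeasurable (by fun_prop) ((hU.prodMk hY).prodMk hZ)]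
    rfl
  have hYZ : IndepFun Y Z P := h.comp measurable_snd measurable_id
  have h₂ : (P.map U).prod (P.map fun ω => (Y ω, Z ω))
      = (((P.map U).prod (P.map Y)).prod (P.map Z)).map MeasurableEquiv.prodAssoc := by
    rw [(indepFun_iff_map_prod_eq_prod_map_map hY hZ).1 hYZ, Measure.prodAssoc_prod]
  refine le_antisymm ?_ (mutualInfo_comp_right_le P hU (hY.prodMk hZ) measurable_fst)
  rw [mutualInfo, mutualInfo, h₁, h₂]
  exact (klDiv_map_le _ _ MeasurableEquiv.prodAssoc.measurable).trans (klDiv_prod_left _ _ _).le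

/-- If `X` can be recovered almost surely from `g X` and a variable independent of the pair
`(U, g X)`, then `g` preserves the information that `X` contains about `U`. -/
theorem mutualInfo_eq_of_indepFun {Ω 𝓤 𝓧 𝓨 𝓩 : Type*} [MeasurableSpace Ω] [MeasurableSpace 𝓤]
    [MeasurableSpace 𝓧] [MeasurableSpace 𝓨] [MeasurableSpace 𝓩] (P : Measure Ω)
    [IsProbabilityMeasure P] {U : Ω → 𝓤} {X : Ω → 𝓧} {Z : Ω → 𝓩} {g : 𝓧 → 𝓨} {f : 𝓨 × 𝓩 → 𝓧}
    (hU : AEMeasurable U P) (hX : AEMeasurable X P) (hZ : AEMeasurable Z P)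
    (hg : Measurable g) (hf : Measurable f)
    (h : IndepFun (fun ω => (U ω, g (X ω))) Z P)
    (hfX : X =ᵐ[P] fun ω => f (g (X ω), Z ω)) :
    mutualInfo P U X = mutualInfo P U (fun ω => g (X ω)) := by
  have hY : AEMeasurable (fun ω => g (X ω)) P := hg.comp_aemeasurable hX
  refine le_antisymm ?_ (mutualInfo_comp_right_le P hU hX hg)
  have h₁ : mutualInfo P U X = mutualInfo P U (fun ω => f (g (X ω), Z ω)) := by
    rw [mutualInfo, mutualInfo, Measure.map_congr hfX, Measure.map_congr (f := fun ω => (U ω, X ω))]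
    filter_upwards [hfX] with ω hω
    rw [← hω]
  rw [h₁, ← mutualInfo_prodMk_of_indepFun P hU hY hZ h]
  exact mutualInfo_comp_right_le P hU (hY.prodMk hZ) hf

theorem mutualInfo_const_left {Ω 𝓤 𝓧 : Type*} [MeasurableSpace Ω] [MeasurableSpace 𝓤]
    [MeasurableSpace 𝓧] (P : Measure Ω) [IsProbabilityMeasure P] (c : 𝓤) {X : Ω → 𝓧}
    (hX : AEMeasurable X P) : mutualInfo P (fun _ => c) X = 0 := by
  have := Measure.isProbabilityMeasure_map hX
  have h : P.map (fun ω => (c, X ω)) = (P.map fun _ => c).prod (P.map X) :=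
    (indepFun_iff_map_prod_eq_prod_map_map aemeasurable_const hX).1
      (indepFun_const_left c X)
  rw [mutualInfo, h, klDiv_self]

/-- The hypotheses factor the joint law of the triple into its three marginals; reassociating the
product regroups the factors. -/
theorem indepFun_prodMk_left {Ω 𝓤 𝓨 𝓩 : Type*} [MeasurableSpace Ω] [MeasurableSpace 𝓤]
    [MeasurableSpace 𝓨] [MeasurableSpace 𝓩] (P : Measure Ω) [IsProbabilityMeasure P]
    {U : Ω → 𝓤} {Y : Ω → 𝓨} {Z : Ω → 𝓩} (hU : AEMeasurable U P) (hY : AEMeasurable Y P)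
    (hZ : AEMeasurable Z P) (h : IndepFun U (fun ω => (Y ω, Z ω)) P) (hYZ : IndepFun Y Z P) :
    IndepFun (fun ω => (U ω, Y ω)) Z P := by
  have := Measure.isProbabilityMeasure_map hU
  have := Measure.isProbabilityMeasure_map hY
  have := Measure.isProbabilityMeasure_map hZ
  have hUY : IndepFun U Y P := h.comp measurable_id measurable_fst
  rw [indepFun_iff_map_prod_eq_prod_map_map (hU.prodMk hY) hZ,
    (indepFun_iff_map_prod_eq_prod_map_map hU hY).1 hUY]
  have h₁ := (indepFun_iff_map_prod_eq_prod_map_map hU (hY.prodMk hZ)).1 h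
  rw [(indepFun_iff_map_prod_eq_prod_map_map hY hZ).1 hYZ, ← Measure.prodAssoc_prod] at h₁
  have h₂ := congrArg (Measure.map MeasurableEquiv.prodAssoc.symm) h₁
  rw [AEMeasurable.map_map_of_aemeasurable (by fun_prop) (hU.prodMk (hY.prodMk hZ)),
    MeasurableEquiv.map_symm_map] at h₂
  exact h₂

/-- If `g` preserves the information about every quantization of `S`, then no information
relevant with respect to `S` is lost. -/
theorem relevantInfoLoss_eq_zero {Ω 𝓢 𝓧 𝓨 : Type*} [MeasurableSpace Ω] [MeasurableSpace 𝓢]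
    [MeasurableSpace 𝓧] [MeasurableSpace 𝓨] (P : Measure Ω) [IsProbabilityMeasure P]
    {S : Ω → 𝓢} {X : Ω → 𝓧} {g : 𝓧 → 𝓨} (hX : AEMeasurable X P) (hg : Measurable g)
    (h : ∀ q : 𝓢 → ℕ, Measurable q → mutualInfo P (fun ω => q (S ω)) X
      = mutualInfo P (fun ω => q (S ω)) (fun ω => g (X ω))) :
    relevantInfoLoss P S X g = 0 := by
  -- Only `≤ 0` holds for a general `q`, because `⊤ - ⊤ = ⊥`; the one-cell partition attains the
  -- value `0`.
  refine le_antisymm (iSup₂_le fun q hq => ?_) (le_iSup₂_of_le (fun _ => 0) measurable_const ?_)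
  · rw [h q hq]
    exact EReal.sub_self_le_zero
  · simp only [mutualInfo_const_left P 0 hX, mutualInfo_const_left P 0 (X := fun ω => g (X ω))
      (hg.comp_aemeasurable hX)]
    simp

/-! ### Spectrum and covariance of the rotated signal and noise -/

theorem eq_zero_of_antitone_of_rank_le {n M : ℕ} {d : Fin n → ℝ} (hd : Antitone d)
    (hd₀ : ∀ i, 0 ≤ d i) (hr : (Matrix.diagonal d).rank ≤ M) {i : Fin n} (hi : M ≤ i) :
    d i = 0 := by
  by_contra hne
  have hpos : 0 < d i := lt_of_le_of_ne (hd₀ i) (Ne.symm hne)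
  rw [Matrix.rank_diagonal, Fintype.card_subtype] at hr
  -- All `i + 1 > M` entries up to index `i` are at least `d i > 0`, too many for the rank.
  have hsub : Finset.Iic i ⊆ Finset.univ.filter fun j => d j ≠ 0 := fun j hj => by
    simpa using (hpos.trans_le (hd (Finset.mem_Iic.1 hj))).ne'
  have := (Finset.card_le_card hsub).trans hr
  rw [Fin.card_Iic] at this
  omega

section Covariance

variable {Ω : Type*} [MeasurableSpace Ω] {P : Measure Ω} {n : ℕ}

theorem MeasureTheory.MemLp.euclidean_eval {S : Ω → EuclideanSpace ℝ (Fin n)} (hS : MemLp S 2 P)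
    (i : Fin n) : MemLp (fun ω => S ω i) 2 P :=
  hS.continuousLinearMap_comp (EuclideanSpace.proj (𝕜 := ℝ) i)

theorem memLp_transpose_mulVec (W : Matrix (Fin n) (Fin n) ℝ)
    {S : Ω → EuclideanSpace ℝ (Fin n)} (hS : MemLp S 2 P) (i : Fin n) :
    MemLp (fun ω => (W.transpose.mulVec (S ω).ofLp) i) 2 P :=
  memLp_finsetSum Finset.univ fun j _ => (hS.euclidean_eval j).const_mul (W j i)

theorem covariance_transpose_mulVec [IsFiniteMeasure P] (W : Matrix (Fin n) (Fin n) ℝ)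
    {S : Ω → EuclideanSpace ℝ (Fin n)} (hS : MemLp S 2 P) (i j : Fin n) :
    cov[fun ω => (W.transpose.mulVec (S ω).ofLp) i,
      fun ω => (W.transpose.mulVec (S ω).ofLp) j; P]
      = (W.transpose * covarianceMatrix P S * W) i j := by
  have h := covariance_fun_sum_fun_sum (μ := P)
    (X := fun k ω => W k i * S ω k) (Y := fun k ω => W k j * S ω k)
    (fun k => (hS.euclidean_eval k).const_mul _) (fun k => (hS.euclidean_eval k).const_mul _)
  refine h.trans ?_
  simp only [covariance_const_mul_left, covariance_const_mul_right, Matrix.mul_apply,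
    Matrix.transpose_apply, covarianceMatrix, Matrix.of_apply, Finset.sum_mul]
  rw [Finset.sum_comm]
  exact Finset.sum_congr rfl fun _ _ => Finset.sum_congr rfl fun _ _ => by ring

theorem covarianceMatrix_add [IsProbabilityMeasure P] {S N X : Ω → EuclideanSpace ℝ (Fin n)}
    (hX : ∀ ω, X ω = S ω + N ω) (hS : MemLp S 2 P) (hN : MemLp N 2 P) (hSN : IndepFun S N P) :
    covarianceMatrix P X = covarianceMatrix P S + covarianceMatrix P N := by
  ext i j
  have hind : ∀ i j, cov[fun ω => S ω i, fun ω => N ω j; P] = 0 := fun i j =>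
    (hSN.comp (φ := fun x : EuclideanSpace ℝ (Fin n) => x i)
      (ψ := fun x : EuclideanSpace ℝ (Fin n) => x j) (by fun_prop)
      (by fun_prop)).covariance_eq_zero (hS.euclidean_eval i) (hN.euclidean_eval j)
  have hX' : ∀ i, (fun ω => X ω i) = (fun ω => S ω i) + fun ω => N ω i := fun i => by
    ext ω; simp [hX]
  simp only [covarianceMatrix, Matrix.of_apply, Matrix.add_apply, hX']
  rw [covariance_add_left (hS.euclidean_eval i) (hN.euclidean_eval i)
      ((hS.euclidean_eval j).add (hN.euclidean_eval j)),
    covariance_add_right (hS.euclidean_eval i) (hS.euclidean_eval j) (hN.euclidean_eval j),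
    covariance_add_right (hN.euclidean_eval i) (hS.euclidean_eval j) (hN.euclidean_eval j),
    hind, covariance_comm (fun ω => N ω i) (fun ω => S ω j), hind]
  ring

theorem covarianceMatrix_of_hasLaw_multivariateGaussian {N : Ω → EuclideanSpace ℝ (Fin n)}
    {m : EuclideanSpace ℝ (Fin n)} {C : Matrix (Fin n) (Fin n) ℝ} (hC : C.PosSemidef)
    (hN : HasLaw N (multivariateGaussian m C) P) : covarianceMatrix P N = C := by
  ext i j
  rw [← covariance_eval_multivariateGaussian (μ := m) hC i j, ← hN.map_eq,
    covariance_map_fun (by fun_prop) (by fun_prop) hN.aemeasurable]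
  rfl

/-- The components of `Wᵀ S` after the first `M` are almost surely constant, if `W` is a PCA matrix
for the covariance matrix of `S` plus a multiple of the identity. -/
theorem ae_eq_integral_of_isPCAMatrix [IsProbabilityMeasure P] {M : ℕ} {c : ℝ}
    {W : Matrix (Fin n) (Fin n) ℝ} {S : Ω → EuclideanSpace ℝ (Fin n)} (hS : MemLp S 2 P)
    (hrank : (covarianceMatrix P S).rank ≤ M)
    (hW : IsPCAMatrix (covarianceMatrix P S + c • (1 : Matrix (Fin n) (Fin n) ℝ)) W)
    {i : Fin n} (hi : M ≤ i) :
    ∀ᵐ ω ∂P, (W.transpose.mulVec (S ω).ofLp) i = ∫ ω, (W.transpose.mulVec (S ω).ofLp) i ∂P := by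
  obtain ⟨horth, l, hl, hCW⟩ := hW
  have hWW : W.transpose * W = 1 := (Matrix.mem_orthogonalGroup_iff' (Fin n) ℝ).1 horth
  have hdiag : W.transpose * covarianceMatrix P S * W = Matrix.diagonal fun i => l i - c := by
    rw [Matrix.add_mul, smul_mul_assoc, one_mul, ← eq_sub_iff_add_eq] at hCW
    rw [Matrix.mul_assoc, hCW, Matrix.mul_sub, ← Matrix.mul_assoc, mul_smul_comm, hWW, one_mul,
      ← Matrix.diagonal_one, ← Matrix.diagonal_smul, Matrix.diagonal_sub]
    simp
  have hvar : ∀ i, Var[fun ω => (W.transpose.mulVec (S ω).ofLp) i; P] = l i - c := fun i => by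
    rw [← covariance_self (memLp_transpose_mulVec W hS i).aemeasurable,
      covariance_transpose_mulVec W hS, hdiag, Matrix.diagonal_apply_eq]
  refine ae_eq_integral_of_variance_eq_zero (memLp_transpose_mulVec W hS i) ?_
  rw [hvar]
  refine eq_zero_of_antitone_of_rank_le (M := M) (d := fun i => l i - c)
    (fun a b hab => sub_le_sub_right (hl hab) c)
    (fun i => hvar i ▸ variance_nonneg _ _) ?_ hi
  rw [← hdiag]
  exact (Matrix.rank_mul_le_left _ _).trans ((Matrix.rank_mul_le_right _ _).trans hrank)

/-- Disjoint groups of components of an isotropic Gaussian vector in a rotated coordinate system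
are independent. -/
theorem indepFun_transpose_mulVec [IsProbabilityMeasure P] {c : ℝ} (hc : 0 ≤ c)
    {W : Matrix (Fin n) (Fin n) ℝ} (hW : W ∈ Matrix.orthogonalGroup (Fin n) ℝ)
    {N : Ω → EuclideanSpace ℝ (Fin n)}
    (hN : HasLaw N (multivariateGaussian 0 (c • (1 : Matrix (Fin n) (Fin n) ℝ))) P)
    (p : Fin n → Prop) :
    IndepFun (fun ω (i : {i // p i}) => (W.transpose.mulVec (N ω).ofLp) i)
      (fun ω (i : {i // ¬ p i}) => (W.transpose.mulVec (N ω).ofLp) i) P := by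
  have hG : HasGaussianLaw N P := hN.hasGaussianLaw
  have hC : (c • (1 : Matrix (Fin n) (Fin n) ℝ)).PosSemidef := Matrix.PosSemidef.one.smul hc
  let L : EuclideanSpace ℝ (Fin n) →ₗ[ℝ] ({i // p i} → ℝ) × ({i // ¬ p i} → ℝ) :=
    ((LinearMap.funLeft ℝ ℝ Subtype.val).prod (LinearMap.funLeft ℝ ℝ Subtype.val)) ∘ₗ
      W.transpose.mulVecLin ∘ₗ (WithLp.linearEquiv 2 ℝ (Fin n → ℝ)).toLinearMap
  -- The two groups are jointly Gaussian as a linear image of `N`, so vanishing cross-covariances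
  -- suffice for independence.
  have hL : HasGaussianLaw (fun ω => L.toContinuousLinearMap (N ω)) P :=
    HasGaussianLaw.map_of_measurable L.toContinuousLinearMap hG
      L.toContinuousLinearMap.continuous.measurable
  refine HasGaussianLaw.indepFun_of_covariance_eval
    (X := fun (i : {i // p i}) ω => (W.transpose.mulVec (N ω).ofLp) i)
    (Y := fun (i : {i // ¬ p i}) ω => (W.transpose.mulVec (N ω).ofLp) i)
    hL fun i j => ?_
  have hij : (i : Fin n) ≠ j := fun h => j.2 (h ▸ i.2)
  rw [covariance_transpose_mulVec W hG.memLp_two,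
    covarianceMatrix_of_hasLaw_multivariateGaussian hC hN, mul_smul_comm, smul_mul_assoc, mul_one,
    (Matrix.mem_orthogonalGroup_iff' (Fin n) ℝ).1 hW]
  simp [hij]

end Covariance

/-! ### The PCA map and the recovery of its input -/

theorem pcaMap_apply {n M : ℕ} (W : Matrix (Fin n) (Fin n) ℝ) (x : EuclideanSpace ℝ (Fin n))
    (k : Fin M) : pcaMap M W x k
      = if h : (k : ℕ) < n then (W.transpose.mulVec x.ofLp) ⟨k, h⟩ else 0 := by
  simp only [pcaMap, ← Matrix.mulVec_mulVec]
  rw [Matrix.mulVec, dotProduct]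
  simp only [truncationMatrix, Matrix.of_apply, ite_mul, one_mul, zero_mul]
  split_ifs with h
  · rw [Finset.sum_eq_single ⟨k, h⟩ (fun j _ hj => if_neg fun hk => hj (Fin.ext hk.symm))
      (by simp), if_pos rfl]
  · exact Finset.sum_eq_zero fun j _ => if_neg fun hk : (k : ℕ) = j => h (hk ▸ j.2)

theorem pcaMap_add {n M : ℕ} (W : Matrix (Fin n) (Fin n) ℝ) (x y : EuclideanSpace ℝ (Fin n)) :
    pcaMap M W (x + y) = pcaMap M W x + pcaMap M W y := by
  simp [pcaMap, Matrix.mulVec_add]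

theorem measurable_transpose_mulVec {n : ℕ} (W : Matrix (Fin n) (Fin n) ℝ) :
    Measurable fun x : EuclideanSpace ℝ (Fin n) => W.transpose.mulVec x.ofLp :=
  (Continuous.matrix_mulVec continuous_const (by fun_prop)).measurable

theorem measurable_pcaMap {n M : ℕ} (W : Matrix (Fin n) (Fin n) ℝ) : Measurable (pcaMap M W) := by
  have : Continuous fun x : EuclideanSpace ℝ (Fin n) =>
      (truncationMatrix M n * W.transpose).mulVec x.ofLp :=
    Continuous.matrix_mulVec continuous_const (by fun_prop)
  exact ((PiLp.continuous_toLp 2 _).comp this).measurable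

/-- The vector `x` with `(Wᵀ x) i = y i` for `i < M` and `(Wᵀ x) i = z i` otherwise. -/
noncomputable def pcaReconstruct {n M : ℕ} (W : Matrix (Fin n) (Fin n) ℝ)
    (v : EuclideanSpace ℝ (Fin M) × ({i : Fin n // ¬ (i : ℕ) < M} → ℝ)) :
    EuclideanSpace ℝ (Fin n) :=
  WithLp.toLp 2 (W.mulVec fun i => if h : (i : ℕ) < M then v.1 ⟨i, h⟩ else v.2 ⟨i, h⟩)

theorem measurable_pcaReconstruct {n M : ℕ} (W : Matrix (Fin n) (Fin n) ℝ) :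
    Measurable (pcaReconstruct (M := M) W) := by
  refine Continuous.measurable ((PiLp.continuous_toLp 2 _).comp
    (Continuous.matrix_mulVec continuous_const (continuous_pi fun i => ?_)))
  split_ifs <;> fun_prop

theorem pcaReconstruct_pcaMap {n M : ℕ} {W : Matrix (Fin n) (Fin n) ℝ}
    (hW : W ∈ Matrix.orthogonalGroup (Fin n) ℝ) (x : EuclideanSpace ℝ (Fin n)) :
    pcaReconstruct W (pcaMap M W x, fun i => (W.transpose.mulVec x.ofLp) i) = x := by
  have h : (fun i : Fin n => if h : (i : ℕ) < M then pcaMap M W x ⟨i, h⟩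
      else (W.transpose.mulVec x.ofLp) i) = W.transpose.mulVec x.ofLp := by
    ext i
    split_ifs <;> simp [pcaMap_apply]
  have hWW : W * W.transpose = 1 := (Matrix.mem_orthogonalGroup_iff (Fin n) ℝ).1 hW
  rw [pcaReconstruct, h, Matrix.mulVec_mulVec, hWW, Matrix.one_mulVec]

/-- For a signal in isotropic Gaussian noise, the signal and the first `M` components of the rotated
observation are independent of the remaining components of the rotated noise. -/
theorem indepFun_prodMk_pcaMap {Ω : Type*} [MeasurableSpace Ω] {P : Measure Ω}
    [IsProbabilityMeasure P] {n M : ℕ} {c : ℝ} (hc : 0 ≤ c) {W : Matrix (Fin n) (Fin n) ℝ}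
    (hW : W ∈ Matrix.orthogonalGroup (Fin n) ℝ) {S N X : Ω → EuclideanSpace ℝ (Fin n)}
    (hX : ∀ ω, X ω = S ω + N ω) (hS : AEMeasurable S P)
    (hN : HasLaw N (multivariateGaussian 0 (c • (1 : Matrix (Fin n) (Fin n) ℝ))) P)
    (hSN : IndepFun S N P) :
    IndepFun (fun ω => (S ω, pcaMap M W (X ω)))
      (fun ω (i : {i : Fin n // ¬ (i : ℕ) < M}) => (W.transpose.mulVec (N ω).ofLp) i) P := by
  have hV := measurable_transpose_mulVec W
  have hcoord : ∀ p : Fin n → Prop, Measurable fun (x : EuclideanSpace ℝ (Fin n)) (i : {i // p i}) =>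
      (W.transpose.mulVec x.ofLp) i := fun p =>
    measurable_pi_lambda _ fun i => (measurable_pi_apply _).comp hV
  have h := indepFun_prodMk_left P hS
    ((hcoord fun i => (i : ℕ) < M).comp_aemeasurable hN.aemeasurable)
    ((hcoord fun i => ¬ (i : ℕ) < M).comp_aemeasurable hN.aemeasurable)
    (hSN.comp measurable_id ((hcoord _).prodMk (hcoord _)))
    (indepFun_transpose_mulVec hc hW hN _)
  -- By linearity the PCA output depends only on `S` and the kept noise coordinates. The value `0`
  -- fills the zero rows of the truncation matrix when `M > n`.
  let φ : EuclideanSpace ℝ (Fin n) × ({i : Fin n // (i : ℕ) < M} → ℝ) →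
      EuclideanSpace ℝ (Fin n) × EuclideanSpace ℝ (Fin M) := fun v =>
    (v.1, pcaMap M W v.1 + WithLp.toLp 2 fun k : Fin M =>
      if h : (k : ℕ) < n then v.2 ⟨⟨k, h⟩, k.2⟩ else 0)
  have hφ : Measurable φ := by
    refine measurable_fst.prodMk (((measurable_pcaMap W).comp measurable_fst).add
      (Continuous.measurable ((PiLp.continuous_toLp 2 _).comp (continuous_pi fun k => ?_))))
    split_ifs <;> fun_prop
  have hY : (fun ω => (S ω, pcaMap M W (X ω)))
      = φ ∘ fun ω => (S ω, fun i : {i : Fin n // (i : ℕ) < M} =>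
        (W.transpose.mulVec (N ω).ofLp) i) := by
    funext ω
    have hNω : pcaMap M W (N ω) = WithLp.toLp 2 fun k : Fin M =>
        if h : (k : ℕ) < n then (W.transpose.mulVec (N ω).ofLp) ⟨k, h⟩ else 0 := by
      ext k
      exact pcaMap_apply W (N ω) k
    rw [hX, pcaMap_add, hNω]
    rfl
  rw [hY]
  exact h.comp hφ measurable_id

theorem mainTheorem2 {Ω : Type*} [MeasurableSpace Ω] (P : Measure Ω) [IsProbabilityMeasure P]
    (n M : ℕ) (S N X : Ω → EuclideanSpace ℝ (Fin n)) (σ : ℝ)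
    (W : Matrix (Fin n) (Fin n) ℝ)
    (hX : ∀ ω, X ω = S ω + N ω)
    (hS : MemLp S 2 P)
    (hrank : (covarianceMatrix P S).rank ≤ M)
    (hN : HasLaw N (multivariateGaussian 0 (σ ^ 2 • (1 : Matrix (Fin n) (Fin n) ℝ))) P)
    (hSN : IndepFun S N P)
    (hW : IsPCAMatrix (covarianceMatrix P X) W) :
    relevantInfoLoss P S X (pcaMap M W) = 0 := by
  have hNG : HasGaussianLaw N P := hN.hasGaussianLaw
  have hXm : AEMeasurable X P := by
    rw [funext hX]
    exact hS.aemeasurable.add hN.aemeasurable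
  rw [covarianceMatrix_add hX hS hNG.memLp_two hSN, covarianceMatrix_of_hasLaw_multivariateGaussian
    (Matrix.PosSemidef.one.smul (sq_nonneg σ)) hN] at hW
  refine relevantInfoLoss_eq_zero P hXm (measurable_pcaMap W) fun q hq => ?_
  have hind := indepFun_prodMk_pcaMap (M := M) (sq_nonneg σ) hW.1 hX hS.aemeasurable hN hSN
  have hZ : AEMeasurable (fun ω (i : {i : Fin n // ¬ (i : ℕ) < M}) =>
      (W.transpose.mulVec (N ω).ofLp) i) P :=
    (measurable_pi_lambda _ fun i => (measurable_pi_apply _).comp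
      (measurable_transpose_mulVec W)).comp_aemeasurable hN.aemeasurable
  let m : {i : Fin n // ¬ (i : ℕ) < M} → ℝ := fun i =>
    ∫ ω, (W.transpose.mulVec (S ω).ofLp) i ∂P
  -- The side information is the discarded noise shifted by the constants `m`; it agrees almost
  -- surely with the discarded part of Wᵀ X, and the shift preserves independence.
  refine mutualInfo_eq_of_indepFun P (f := pcaReconstruct W) (hq.comp_aemeasurable hS.aemeasurable)
    hXm (hZ.const_add m) (measurable_pcaMap W) (measurable_pcaReconstruct W)
    (hind.comp ((hq.comp measurable_fst).prodMk measurable_snd) (measurable_const_add m)) ?_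
  have hae : ∀ᵐ ω ∂P, ∀ i : {i : Fin n // ¬ (i : ℕ) < M},
      (W.transpose.mulVec (S ω).ofLp) i = m i :=
    ae_all_iff.2 fun i => ae_eq_integral_of_isPCAMatrix hS hrank hW (not_lt.1 i.2)
  filter_upwards [hae] with ω hω
  refine (pcaReconstruct_pcaMap (M := M) hW.1 (X ω)).symm.trans ?_
  refine congrArg (fun z => pcaReconstruct W (pcaMap M W (X ω), z)) ?_
  ext i
  simp [hX, Matrix.mulVec_add, hω]
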